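/- Let $S\subset\mathbb{R}^d$ be a smooth surface, that is, an embedded $C^\infty$ submanifold without boundary, of any dimension and codimension. Let $\Omega\subset\mathbb{R}^d$ be an open set containing $S$, and let $\mathrm{cp}:\Omega\to S$ be a closest point function, i.e. for every $x\in\Omega$, $\mathrm{cp}(x)$ is a (possibly non-unique) point of $S$ closest to $x$. Suppose that $v:\Omega\to\mathbb{R}$ and $\lambda\in\mathbb{R}$ solve the unregularized embedded eigenvalue problem $$-\Delta\big(v(\mathrm{cp}(x))\big)=\lambda\,v(x)\qquad\text{for all } x\in\Omega,$$ in the classical sense: $v\circ\mathrm{cp}$ is of class $C^2$ on $\Omega$ (nothing else is required of $v$ off $S$), and $\Delta$ is the Laplacian of $\mathbb{R}^d$. Then $u:S\to\mathbb{R}$ defined by $u(x)=v(x)$ for $x\in S$ is of class $C^2$ on $S$ and solves the Laplace--Beltrami eigenvalue problem with the same $\lambda$: $$-\Delta_S u(x)=-\nabla_S\cdot\nabla_S u(x)=\lambda\,u(x)\qquad\text{for all } x\in S.$$ Moreover, if $v$ is not identically zero on $\Omega$, and either $\lambda\neq 0$ or $v$ is not identically zero on $S$, then $u$ is not identically zero,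 so it is a Laplace--Beltrami eigenfunction on $S$ with eigenvalue $\lambda$. -/

import Mathlib

open Set
open scoped ContDiff RealInnerProductSpace

namespace ClosestPoint

/-- The Euclidean space `ℝ^d`. -/
abbrev Space (d : ℕ) := EuclideanSpace ℝ (Fin d)

/-- `S` is a smooth surface in `ℝ^d`: an embedded `C^∞` submanifold without boundary, of arbitrary
dimension and codimension. Around each of its points, a smooth diffeomorphism `Φ` between open
subsets of `ℝ^d` straightens `S` to a linear subspace `L`. -/
def IsSmoothSurface {d : ℕ} (S : Set (Space d)) : Prop :=
  ∀ p ∈ S, ∃ (Φ : OpenPartialHomeomorph (Space d) (Space d)) (L : Submodule ℝ (Space d)),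
    p ∈ Φ.source ∧
    ContDiffOn ℝ ∞ Φ Φ.source ∧ ContDiffOn ℝ ∞ Φ.symm Φ.target ∧
    Φ '' (Φ.source ∩ S) = Φ.target ∩ (L : Set (Space d))

/-- `cp` is a closest point function of `S` on `Ω`: for every `x ∈ Ω`, `cp x` is a (possibly
non-unique) point of `S` which is closest to `x`. -/
def IsClosestPointMap {d : ℕ} (S Ω : Set (Space d)) (cp : Space d → Space d) : Prop :=
  ∀ x ∈ Ω, cp x ∈ S ∧ ∀ y ∈ S, dist x (cp x) ≤ dist x y

/-- The tangent space `T_x S`, as a linear subspace of `ℝ^d`. -/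
def tangentSpaceAt {d : ℕ} (S : Set (Space d)) (x : Space d) : Submodule ℝ (Space d) :=
  Submodule.span ℝ (tangentConeAt ℝ S x)

/-- `g` is the surface gradient `∇_S u (x)`: the vector tangent to `S` at `x` with
`u y = u x + ⟪g, y - x⟫ + o(|y - x|)` as `y → x` along `S`. -/
def HasSurfaceGradientAt {d : ℕ} (S : Set (Space d)) (u : Space d → ℝ) (g x : Space d) : Prop :=
  g ∈ tangentSpaceAt S x ∧ HasFDerivWithinAt u (innerSL ℝ g) S x

/-- `δ` is the surface divergence `∇_S · F (x)`: the trace over `T_x S` of `P ∘ A`, where `A` is the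
derivative of `F` at `x` along `S` and `P` is the orthogonal projection of `ℝ^d` onto `T_x S`. -/
def HasSurfaceDivergenceAt {d : ℕ} (S : Set (Space d)) (F : Space d → Space d) (δ : ℝ)
    (x : Space d) : Prop :=
  ∃ A : Space d →L[ℝ] Space d, HasFDerivWithinAt F A S x ∧
    δ = LinearMap.trace ℝ (tangentSpaceAt S x)
      (((tangentSpaceAt S x).orthogonalProjectionOnto ∘L A ∘L (tangentSpaceAt S x).subtypeL :
        tangentSpaceAt S x →L[ℝ] tangentSpaceAt S x) :
        tangentSpaceAt S x →ₗ[ℝ] tangentSpaceAt S x)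

/-- `ℓ` is the value at `x` of the Laplace–Beltrami operator `Δ_S u = ∇_S · ∇_S u`. Only the values
of `u` on `S` matter. -/
def HasLaplaceBeltramiAt {d : ℕ} (S : Set (Space d)) (u : Space d → ℝ) (ℓ : ℝ)
    (x : Space d) : Prop :=
  ∃ G : Space d → Space d, (∀ y ∈ S, HasSurfaceGradientAt S u (G y) y) ∧
    HasSurfaceDivergenceAt S G ℓ x

/-- `u` and `lam` solve the surface problem: `u` is of class `C²` on `S` (as a function on
`S`: for a smooth surface this means that `u` is `C²` in smooth local parametrizations of `S`), and
`-Δ_S u = lam u` on `S`. -/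
def SolvesSurfaceProblem {d : ℕ} (S : Set (Space d)) (u : Space d → ℝ) (lam : ℝ) : Prop :=
  ContDiffOn ℝ 2 u S ∧ ∀ x ∈ S, ∃ ℓ : ℝ, HasLaplaceBeltramiAt S u ℓ x ∧ -ℓ = lam * u x

/-- `u` is a Laplace–Beltrami eigenfunction on `S` with eigenvalue `lam`: a solution of the surface
problem which is not identically zero on `S`. -/
def IsSurfaceEigenfunction {d : ℕ} (S : Set (Space d)) (u : Space d → ℝ) (lam : ℝ) : Prop :=
  SolvesSurfaceProblem S u lam ∧ ∃ x ∈ S, u x ≠ 0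

/-- `v` and `lam` solve the embedded problem: `v ∘ cp` is of class `C²` on `Ω`, and
`-Δ (v ∘ cp) = lam v` on `Ω`. Nothing else is required of `v` off the surface. -/
def SolvesEmbeddedProblem {d : ℕ} (Ω : Set (Space d)) (cp : Space d → Space d)
    (v : Space d → ℝ) (lam : ℝ) : Prop :=
  ContDiffOn ℝ 2 (fun x => v (cp x)) Ω ∧
    ∀ x ∈ Ω, -(Laplacian.laplacian (fun x => v (cp x)) : Space d → ℝ) x = lam * v x

end ClosestPoint

/-!
Write `w = v ∘ cp`. On `S` the closest point is the point itself, so `w = v = u` there; in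
particular `u` is the restriction of a `C²` function on a neighbourhood of `S`, and is `C²` on `S`.

The geometric fact behind the theorem is `ClosestPoint.IsClosestPointMap.eventually_eq_of_normal`:
if `n` is normal to `S` at `y`, then `cp (y + t n) = y` for all small `t`. It holds because `S` is
tangent to its tangent space to second order, `⟪n, z - y⟫ = O(‖n‖ ‖z - y‖²)` for `z ∈ S` near `y`
(`ClosestPoint.IsSmoothSurface.exists_inner_sub_le`), so that for small `t` moving from `y` to
another nearby `z ∈ S` changes the squared distance to `y + t n` by
`‖z - y‖² - 2 t ⟪n, z - y⟫ > 0`, while the points of `S` far from `y` are no candidates.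
No tubular neighbourhood is needed, as the smallness of `t` may depend on `y` and on `n`.

Hence `w` is constant along short normal segments. Its first derivative along them vanishes, so the
gradient of `w` is tangent to `S` at every point of `S`, and it is the surface gradient of `u`. Its
second derivative along them vanishes as well, so the normal directions contribute nothing to the
trace of the Hessian: `Δ w` equals the trace over the tangent space, which is the surface divergence
of `∇ w`. Thus `Δ_S u = Δ w = -lam v` on `S`.

If `u` vanished on `S`, then `w` would vanish on `Ω`, and so would `lam v = -Δ w`.
-/

/-- The remainder of the first order Taylor expansion of a `C²` function is quadratic. -/
theorem ContDiffAt.sub_sub_fderiv_isBigO {E F : Type*} [NormedAddCommGroup E] [NormedSpace ℝ E]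
    [NormedAddCommGroup F] [NormedSpace ℝ F] {f : E → F} {a : E} (hf : ContDiffAt ℝ 2 f a) :
    (fun x => f x - f a - fderiv ℝ f a (x - a)) =O[nhds a] fun x => ‖x - a‖ ^ 2 := by
  have hd : DifferentiableAt ℝ (fderiv ℝ f) a :=
    (hf.fderiv_right (m := 1) (by norm_num)).differentiableAt (by norm_num)
  obtain ⟨C, hC⟩ := hd.hasFDerivAt.isBigO_sub.bound
  have hdiff : ∀ᶠ x in nhds a, DifferentiableAt ℝ f x :=
    (hf.eventually (by simp)).mono fun x hx => hx.differentiableAt (by norm_num)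
  obtain ⟨ε, hε, hball⟩ := Metric.eventually_nhds_iff_ball.1 (hC.and hdiff)
  refine Asymptotics.IsBigO.of_bound (max C 0) ?_
  filter_upwards [Metric.ball_mem_nhds a hε] with x hx
  have hsub : Metric.closedBall a ‖x - a‖ ⊆ Metric.ball a ε :=
    Metric.closedBall_subset_ball (by simpa [dist_eq_norm] using hx)
  have := (convex_closedBall a ‖x - a‖).norm_image_sub_le_of_norm_fderiv_le' (𝕜 := ℝ)
    (f := f) (φ := fderiv ℝ f a) (C := max C 0 * ‖x - a‖) (x := a) (y := x)
    (fun z hz => (hball z (hsub hz)).2)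
    (fun z hz => ((hball z (hsub hz)).1).trans (mul_le_mul (le_max_left _ _)
      (by simpa [dist_eq_norm] using hz) (norm_nonneg _) (le_max_right _ _)))
    (by simp) (by simp [dist_eq_norm])
  simpa [pow_two, mul_assoc] using this

/-- The trace of an operator is the sum of the traces of its compressions to a subspace and to the
orthogonal complement. -/
theorem LinearMap.trace_eq_trace_compression_add {E : Type*} [NormedAddCommGroup E]
    [InnerProductSpace ℝ E] [FiniteDimensional ℝ E] (T : Submodule ℝ E) (A : E →L[ℝ] E) :
    LinearMap.trace ℝ E (A : E →ₗ[ℝ] E) =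
      LinearMap.trace ℝ T ((T.orthogonalProjectionOnto ∘L A ∘L T.subtypeL : T →L[ℝ] T) :
        T →ₗ[ℝ] T) +
      LinearMap.trace ℝ Tᗮ ((Tᗮ.orthogonalProjectionOnto ∘L A ∘L Tᗮ.subtypeL : Tᗮ →L[ℝ] Tᗮ) :
        Tᗮ →ₗ[ℝ] Tᗮ) := by
  have key : ∀ U : Submodule ℝ E,
      LinearMap.trace ℝ U ((U.orthogonalProjectionOnto ∘L A ∘L U.subtypeL : U →L[ℝ] U) :
        U →ₗ[ℝ] U) =
      LinearMap.trace ℝ E ((U.starProjection ∘L A : E →L[ℝ] E) : E →ₗ[ℝ] E) := fun U =>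
    LinearMap.trace_comp_comm' U.subtype
      ((U.orthogonalProjectionOnto : E →ₗ[ℝ] U) ∘ₗ (A : E →ₗ[ℝ] E))
  rw [key, key, ← map_add]
  congr 1
  ext x
  simp

namespace ClosestPoint

variable {d : ℕ}

/-- In a straightening chart, the derivative of the inverse chart maps the model subspace into the
tangent space. -/
theorem fderiv_chart_symm_mem_tangentSpaceAt {S : Set (Space d)}
    {Φ : OpenPartialHomeomorph (Space d) (Space d)} {L : Submodule ℝ (Space d)} {y : Space d}
    (hy : y ∈ Φ.source) (hyL : Φ y ∈ L) (hS : Φ '' (Φ.source ∩ S) = Φ.target ∩ L)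
    (hΦ : DifferentiableAt ℝ Φ.symm (Φ y)) {l : Space d} (hl : l ∈ L) :
    fderiv ℝ Φ.symm (Φ y) l ∈ tangentSpaceAt S y := by
  apply Submodule.subset_span
  have h1 : l ∈ tangentConeAt ℝ (L ∩ Φ.target : Set (Space d)) (Φ y) := by
    rw [tangentConeAt_inter_nhds (Φ.open_target.mem_nhds (Φ.map_source hy))]
    have := mem_tangentConeAt_of_segment_subset
      (L.convex.segment_subset hyL (L.add_mem hyL hl))
    simpa using this
  have h2 := (hΦ.hasFDerivAt.hasFDerivWithinAt (s := L ∩ Φ.target)).mapsTo_tangent_cone h1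
  rw [Φ.left_inv hy] at h2
  refine tangentConeAt_mono ?_ h2
  rw [inter_comm, ← hS]
  rintro _ ⟨_, ⟨z, hz, rfl⟩, rfl⟩
  rw [Φ.left_inv hz.1]
  exact hz.2

/-- A smooth surface is tangent to its tangent space to second order. -/
theorem IsSmoothSurface.exists_inner_sub_le {S : Set (Space d)} (hS : IsSmoothSurface S)
    {y : Space d} (hy : y ∈ S) :
    ∃ C > 0, ∀ᶠ z in nhds y, z ∈ S → ∀ n ∈ (tangentSpaceAt S y)ᗮ,
      |⟪n, z - y⟫| ≤ C * ‖n‖ * ‖z - y‖ ^ 2 := by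
  obtain ⟨Φ, L, hyΦ, hΦ, hΨ, hL⟩ := hS y hy
  have hLmem : ∀ z ∈ Φ.source, z ∈ S → Φ z ∈ L := fun z hz hzS =>
    (hL.subset ⟨z, ⟨hz, hzS⟩, rfl⟩).2
  have hΦ' : ContDiffAt ℝ ∞ Φ y := hΦ.contDiffAt (Φ.open_source.mem_nhds hyΦ)
  have hΨ' : ContDiffAt ℝ ∞ Φ.symm (Φ y) :=
    hΨ.contDiffAt (Φ.open_target.mem_nhds (Φ.map_source hyΦ))
  have hO := ((contDiffAt_infty.1 hΨ' 2).sub_sub_fderiv_isBigO.comp_tendsto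
    hΦ'.continuousAt).trans
    ((hΦ'.differentiableAt (by simp)).hasFDerivAt.isBigO_sub.norm_norm.pow 2)
  obtain ⟨C, hC0, hC⟩ := hO.exists_pos
  refine ⟨C, hC0, ?_⟩
  filter_upwards [hC.bound, Φ.open_source.mem_nhds hyΦ] with z hz hzs hzS n hn
  have htan := fderiv_chart_symm_mem_tangentSpaceAt hyΦ (hLmem y hyΦ hy) hL
    (hΨ'.differentiableAt (by simp)) (L.sub_mem (hLmem z hzs hzS) (hLmem y hyΦ hy))
  have h0 : ⟪n, fderiv ℝ Φ.symm (Φ y) (Φ z - Φ y)⟫ = 0 :=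
    Submodule.inner_left_of_mem_orthogonal htan hn
  simp only [Function.comp_apply, Φ.left_inv hzs, Φ.left_inv hyΦ] at hz
  calc |⟪n, z - y⟫| = |⟪n, z - y - fderiv ℝ Φ.symm (Φ y) (Φ z - Φ y)⟫| := by
        rw [inner_sub_right (y := z - y), h0, sub_zero]
    _ ≤ ‖n‖ * ‖z - y - fderiv ℝ Φ.symm (Φ y) (Φ z - Φ y)‖ := abs_real_inner_le_norm _ _
    _ ≤ ‖n‖ * (C * ‖z - y‖ ^ 2) := by
        gcongr
        simpa using hz
    _ = C * ‖n‖ * ‖z - y‖ ^ 2 := by ring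

theorem IsClosestPointMap.eq_self {S Ω : Set (Space d)} {cp : Space d → Space d}
    (hcp : IsClosestPointMap S Ω cp) (hSΩ : S ⊆ Ω) {y : Space d} (hy : y ∈ S) : cp y = y := by
  have := (hcp y (hSΩ hy)).2 y hy
  rw [dist_self] at this
  exact (dist_le_zero.1 this).symm

/-- Points on a short segment normal to the surface have the foot of the segment as their only
closest point. -/
theorem IsClosestPointMap.eventually_eq_of_normal {S Ω : Set (Space d)}
    {cp : Space d → Space d} (hcp : IsClosestPointMap S Ω cp) (hS : IsSmoothSurface S)
    (hΩ : IsOpen Ω) (hSΩ : S ⊆ Ω) {y n : Space d} (hy : y ∈ S)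
    (hn : n ∈ (tangentSpaceAt S y)ᗮ) :
    ∀ᶠ t in nhds (0 : ℝ), cp (y + t • n) = y := by
  obtain ⟨C, hC0, hC⟩ := hS.exists_inner_sub_le hy
  obtain ⟨ε, hε, hball⟩ := Metric.eventually_nhds_iff_ball.1 hC
  have hcont : Filter.Tendsto (fun t : ℝ => y + t • n) (nhds 0) (nhds y) := by
    have : Continuous fun t : ℝ => y + t • n := by fun_prop
    simpa using this.tendsto 0
  have hnorm : Filter.Tendsto (fun t : ℝ => ‖t • n‖) (nhds 0) (nhds 0) := by
    have : Continuous fun t : ℝ => ‖t • n‖ := by fun_prop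
    simpa using this.tendsto 0
  filter_upwards [hcont.eventually (hΩ.mem_nhds (hSΩ hy)),
    hnorm.eventually (gt_mem_nhds (half_pos hε)),
    hnorm.eventually (gt_mem_nhds (show (0 : ℝ) < 1 / (2 * C) by positivity))] with t htΩ ht1 ht2
  obtain ⟨hzS, hzmin⟩ := hcp _ htΩ
  set z := cp (y + t • n) with hz
  have hle : ‖t • n - (z - y)‖ ≤ ‖t • n‖ := by
    have := hzmin y hy
    rw [dist_eq_norm, dist_eq_norm] at this
    rwa [add_sub_cancel_left, show y + t • n - z = t • n - (z - y) by abel] at this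
  -- By minimality `z` is within `2 ‖t n‖` of `y`, hence in the range of the quadratic estimate.
  have hzε : z ∈ Metric.ball y ε := by
    rw [mem_ball_iff_norm]
    have : ‖z - y‖ ≤ ‖t • n‖ + ‖t • n - (z - y)‖ := by
      simpa using norm_sub_le (t • n) (t • n - (z - y))
    linarith
  have hquad := hball z hzε hzS (t • n) (Submodule.smul_mem _ _ hn)
  have hexp := norm_sub_sq_real (t • n) (z - y)
  have hsq : ‖t • n - (z - y)‖ ^ 2 ≤ ‖t • n‖ ^ 2 := by gcongr
  have hC2 : 2 * C * ‖t • n‖ < 1 := by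
    rw [lt_div_iff₀ (by positivity)] at ht2
    linarith
  have hzero : ‖z - y‖ ^ 2 ≤ 0 := by
    by_contra! hpos
    have := mul_lt_mul_of_pos_right hC2 hpos
    have := le_abs_self ⟪t • n, z - y⟫
    nlinarith
  have : ‖z - y‖ = 0 := by
    have := sq_nonneg ‖z - y‖
    exact pow_eq_zero_iff two_ne_zero |>.1 (le_antisymm hzero this)
  exact sub_eq_zero.1 (norm_eq_zero.1 this)

/-- A `C²` function that is constant on a short segment through `y` in direction `n` has vanishing
first and second derivatives at `y` in this direction. -/
theorem fderiv_eq_zero_of_eventually_const {w : Space d → ℝ} {y n : Space d}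
    (hw : ContDiffAt ℝ 2 w y) (h : ∀ᶠ t in nhds (0 : ℝ), w (y + t • n) = w y) :
    fderiv ℝ w y n = 0 ∧ fderiv ℝ (fderiv ℝ w) y n n = 0 := by
  have hline : ∀ t : ℝ, HasDerivAt (fun s : ℝ => y + s • n) n t := fun t => by
    simpa using ((hasDerivAt_id t).smul_const n).const_add y
  have hcont : Filter.Tendsto (fun t : ℝ => y + t • n) (nhds 0) (nhds y) := by
    simpa using (hline 0).continuousAt.tendsto
  have hev : ∀ᶠ t in nhds (0 : ℝ), fderiv ℝ w (y + t • n) n = 0 := by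
    filter_upwards [h.eventually_nhds, hcont.eventually (hw.eventually (by simp))] with t ht hwt
    have h1 : HasDerivAt (fun s : ℝ => w (y + s • n)) (fderiv ℝ w (y + t • n) n) t :=
      (hwt.differentiableAt (by norm_num)).hasFDerivAt.comp_hasDerivAt t (hline t)
    have h2 : HasDerivAt (fun s : ℝ => w (y + s • n)) 0 t :=
      (hasDerivAt_const t (w y)).congr_of_eventuallyEq ht
    exact h1.unique h2
  refine ⟨by simpa using hev.self_of_nhds, ?_⟩
  have hd : HasFDerivAt (fun x => fderiv ℝ w x n)
      ((fderiv ℝ (fderiv ℝ w) y).flip n) (y + (0 : ℝ) • n) := by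
    have := ((hw.fderiv_right (m := 1) (by norm_num)).differentiableAt
      (by norm_num)).hasFDerivAt.clm_apply (hasFDerivAt_const n y)
    simpa using this
  have h1 : HasDerivAt (fun s : ℝ => fderiv ℝ w (y + s • n) n)
      ((fderiv ℝ (fderiv ℝ w) y).flip n n) 0 := by
    have := hd.comp_hasDerivAt (0 : ℝ) (hline 0)
    exact this
  have h2 : HasDerivAt (fun s : ℝ => fderiv ℝ w (y + s • n) n) 0 0 :=
    (hasDerivAt_const 0 (0 : ℝ)).congr_of_eventuallyEq hev
  simpa using h1.unique h2

/-- The Riesz isomorphism from the dual of `ℝ^d` to `ℝ^d` as a linear map. Mathlib's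
`InnerProductSpace.toDual` is conjugate-linear, which over `ℝ` is the same, but not syntactically. -/
noncomputable def rieszVector (d : ℕ) : StrongDual ℝ (Space d) →L[ℝ] Space d :=
  LinearMap.toContinuousLinearMap
    { toFun := (InnerProductSpace.toDual ℝ (Space d)).symm
      map_add' := map_add _
      map_smul' := fun c f => by simp }

/-- The Hessian of `w` at `x` as an operator, the derivative of the gradient field. -/
noncomputable def hessian (w : Space d → ℝ) (x : Space d) : Space d →L[ℝ] Space d :=
  rieszVector d ∘L fderiv ℝ (fderiv ℝ w) x

theorem inner_hessian (w : Space d → ℝ) (x a b : Space d) :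
    ⟪b, hessian w x a⟫ = fderiv ℝ (fderiv ℝ w) x a b := by
  rw [real_inner_comm]
  simp [hessian, rieszVector]

theorem hasFDerivAt_gradient {w : Space d → ℝ} {x : Space d} (hw : ContDiffAt ℝ 2 w x) :
    HasFDerivAt (gradient w) (hessian w x) x :=
  (rieszVector d).hasFDerivAt.comp x
    ((hw.fderiv_right (m := 1) (by norm_num)).differentiableAt (by norm_num)).hasFDerivAt

theorem laplacian_eq_trace_hessian (w : Space d → ℝ) (x : Space d) :
    (Laplacian.laplacian w : Space d → ℝ) x =
      LinearMap.trace ℝ (Space d) (hessian w x : Space d →ₗ[ℝ] Space d) := by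
  rw [InnerProductSpace.laplacian_eq_iteratedFDeriv_stdOrthonormalBasis,
    LinearMap.trace_eq_sum_inner _ (stdOrthonormalBasis ℝ (Space d))]
  simp [iteratedFDeriv_two_apply, inner_hessian]

/-- A `C²` function which is constant along short normal segments of `S` has its gradient as surface
gradient, and its Laplacian is the Laplace–Beltrami operator of its restriction to `S`. -/
theorem hasLaplaceBeltramiAt_of_eventually_const_normal {S : Set (Space d)} {u w : Space d → ℝ}
    (hw : ∀ y ∈ S, ContDiffAt ℝ 2 w y) (huw : ∀ y ∈ S, u y = w y)
    (h : ∀ y ∈ S, ∀ n ∈ (tangentSpaceAt S y)ᗮ, ∀ᶠ t in nhds (0 : ℝ), w (y + t • n) = w y)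
    {x : Space d} (hx : x ∈ S) :
    HasLaplaceBeltramiAt S u ((Laplacian.laplacian w : Space d → ℝ) x) x := by
  refine ⟨gradient w, fun y hy => ⟨?_, ?_⟩, hessian w x,
    (hasFDerivAt_gradient (hw x hx)).hasFDerivWithinAt, ?_⟩
  · rw [← Submodule.orthogonal_orthogonal (tangentSpaceAt S y), Submodule.mem_orthogonal']
    intro n hn
    simpa [gradient] using (fderiv_eq_zero_of_eventually_const (hw y hy) (h y hy n hn)).1
  · have hd : HasFDerivAt w (innerSL ℝ (gradient w y)) y :=
      ((hw y hy).differentiableAt (by norm_num)).hasGradientAt.hasFDerivAt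
    exact hd.hasFDerivWithinAt.congr huw (huw y hy)
  · rw [laplacian_eq_trace_hessian, LinearMap.trace_eq_trace_compression_add (tangentSpaceAt S x),
      add_eq_left,
      LinearMap.trace_eq_sum_inner _ (stdOrthonormalBasis ℝ (tangentSpaceAt S x)ᗮ)]
    refine Finset.sum_eq_zero fun i _ => ?_
    have hn := (stdOrthonormalBasis ℝ (tangentSpaceAt S x)ᗮ i).2
    simpa [inner_hessian] using (fderiv_eq_zero_of_eventually_const (hw x hx) (h x hx _ hn)).2

end ClosestPoint

theorem theorem3 (d : ℕ) (S Ω : Set (ClosestPoint.Space d))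
    (hS : ClosestPoint.IsSmoothSurface S) (hΩ : IsOpen Ω) (hSΩ : S ⊆ Ω)
    (cp : ClosestPoint.Space d → ClosestPoint.Space d)
    (hcp : ClosestPoint.IsClosestPointMap S Ω cp)
    (v : ClosestPoint.Space d → ℝ) (lam : ℝ)
    (hv : ClosestPoint.SolvesEmbeddedProblem Ω cp v lam)
    (u : ClosestPoint.Space d → ℝ) (hu : ∀ x ∈ S, u x = v x) :
    ClosestPoint.SolvesSurfaceProblem S u lam ∧
      ((∃ x ∈ Ω, v x ≠ 0) → (lam ≠ 0 ∨ ∃ x ∈ S, v x ≠ 0) →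
        ClosestPoint.IsSurfaceEigenfunction S u lam) := by
  obtain ⟨hw, hΔ⟩ := hv
  have huw : ∀ y ∈ S, u y = v (cp y) := fun y hy => by rw [hu y hy, hcp.eq_self hSΩ hy]
  have hsol : ClosestPoint.SolvesSurfaceProblem S u lam := by
    refine ⟨(hw.mono hSΩ).congr huw, fun x hx => ⟨_,
      ClosestPoint.hasLaplaceBeltramiAt_of_eventually_const_normal
        (fun y hy => hw.contDiffAt (hΩ.mem_nhds (hSΩ hy))) huw (fun y hy n hn => ?_) hx, ?_⟩⟩
    · filter_upwards [hcp.eventually_eq_of_normal hS hΩ hSΩ hy hn] with t ht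
      rw [ht, hcp.eq_self hSΩ hy]
    · rw [hΔ x (hSΩ hx), hu x hx]
  refine ⟨hsol, fun ⟨x, hx, hvx⟩ hor => ⟨hsol, ?_⟩⟩
  rcases hor with hlam | ⟨y, hy, hvy⟩
  · by_contra! hzero
    have hw0 : (fun x => v (cp x)) =ᶠ[nhds x] fun _ => (0 : ℝ) := by
      filter_upwards [hΩ.mem_nhds hx] with z hz
      rw [← hu _ (hcp z hz).1, hzero _ (hcp z hz).1]
    have := hΔ x hx
    rw [(InnerProductSpace.laplacian_congr_nhds hw0).self_of_nhds,
      InnerProductSpace.laplacian_const] at this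
    simp_all
  · exact ⟨y, hy, by rwa [hu y hy]⟩
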